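/- Let $R$ be a commutative ring and let $\mathsf{MOD}_R$ be the symmetric monoidal category of $R$-modules, with symmetry $\sigma$ and unit object $R$. A commutative differential $R$-algebra is a commutative $R$-algebra $A$ with an $R$-linear map $D:A\to A$ such that $D(ab)=D(a)b+aD(b)$; its maps are the $R$-algebra morphisms commuting with $D$. For an $R$-module $M$ with inclusions $\iota_n:M\to\bigoplus_{n\ge 0}M$, let $\mathsf{Diff}(M)=\mathsf{Sym}\big(\bigoplus_{n\ge 0}M\big)$ with the unique derivation $D$ such that $D(\iota_n m)=\iota_{n+1}m$. Composites are written in diagrammatic order, and coherence isomorphisms of $\otimes$ are omitted. Let $(T,\mu,\eta)$ be a monad on an additive symmetric monoidal category with unit object $K$. - Natural transformations $\nabla:T A\otimes T A\to T A$ and $u:K\to T A$ make $T$ an algebra modality if every $(TA,\nabla,u)$ is a commutative monoid and $\nabla\mu=(\mu\otimes\mu)\nabla$. - With natural transformations $\Delta:TA\to TA\otimes TA$ and $e:TA\to K$ it is a bialgebra modality if moreover every $(TA,\nabla,u,\Delta,e)$ is a commutative and cocommutative bialgebra and $\eta\Delta=\eta\otimes u+u\otimes\eta$. It is additive if also $T(f+g)=\Delta(T(f)\otimes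 T(g))\nabla$ for all parallel maps $f,g$, and $T(0)=e\,u$. - A deriving transformation for an algebra modality is a natural transformation $\mathsf b:TA\to TA\otimes A$ satisfying the constant rule $u\mathsf b=0$; the Leibniz rule $\nabla\mathsf b=(1\otimes\mathsf b)(\nabla\otimes 1)+(\mathsf b\otimes 1)(1\otimes\sigma)(\nabla\otimes 1)$; the linear rule $\eta\mathsf b=u\otimes 1$; the chain rule $\mu\mathsf b=\mathsf b(\mu\otimes\mathsf b)(\nabla\otimes 1)$; and the interchange rule $\mathsf b(\mathsf b\otimes 1)(1\otimes\sigma)=\mathsf b(\mathsf b\otimes 1)$. (These are the duals of the notions of coalgebra modality, additive bialgebra modality and deriving transformation.) Theorem. 1. $M\mapsto(\mathsf{Diff}(M),D)$ is left adjoint to the forgetful functor from commutative differential $R$-algebras to $R$-modules. The induced monad on $\mathsf{MOD}_R$ has as unit $\alpha:M\to\mathsf{Diff}(M)$ the map $\iota_0$ followed by the inclusion of generators, and as multiplication $\nu:\mathsf{Diff}(\mathsf{Diff}(M))\to\mathsf{Diff}(M)$ the map $\mathsf{Sym}(\psi)$ followed by the multiplication of the monad $\mathsf{Sym}$, where $\psi:\bigoplus_{n\ge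 0}\mathsf{Diff}(M)\to\mathsf{Diff}(M)$ is $D^n$ on the $n$-th summand. 2. With $\nabla,u$ the multiplication and unit of the symmetric algebra, and $\Delta,e$ the algebra morphisms given on generators $v$ by $\Delta(v)=v\otimes 1+1\otimes v$ and $e(v)=0$, this monad is an additive bialgebra modality. 3. If $\mathsf{Diff}$ with $\nabla,u$ admits a deriving transformation, then $1_{M\otimes M}=-\sigma:M\otimes M\to M\otimes M$ for every $R$-module $M$, and $1=0$ in $R$. 4. Consequently, if $R$ is non-trivial, then $\mathsf{Diff}$ does not admit a deriving transformation. -/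

import Mathlib

open CategoryTheory MonoidalCategory
open scoped DirectSum

universe u

/-! ### Algebra modalities and deriving transformations

These are the notions dual to coalgebra modalities, (additive) bialgebra modalities and deriving
transformations.  Composition `f ≫ g` is in diagrammatic order, `▷`, `◁` are tensoring with an
identity, `β_` is the symmetry. -/

section Modalities

variable {C : Type*} [Category C] [MonoidalCategory C] [SymmetricCategory C]

/-- `(T, ∇, u)` is an algebra modality: each `T A` is, naturally in `A`, a commutative monoid, and
the multiplication of the monad `T` preserves the multiplication `∇`. -/
structure IsAlgebraModality (T : Monad C) (mul : ∀ A : C, T.obj A ⊗ T.obj A ⟶ T.obj A)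
    (unit : ∀ A : C, 𝟙_ C ⟶ T.obj A) : Prop where
  mul_natural : ∀ {A B : C} (f : A ⟶ B), (T.map f ⊗ₘ T.map f) ≫ mul B = mul A ≫ T.map f
  unit_natural : ∀ {A B : C} (f : A ⟶ B), unit A ≫ T.map f = unit B
  mul_assoc : ∀ A : C, (mul A ▷ T.obj A) ≫ mul A =
    (α_ (T.obj A) (T.obj A) (T.obj A)).hom ≫ (T.obj A ◁ mul A) ≫ mul A
  unit_mul : ∀ A : C, (unit A ▷ T.obj A) ≫ mul A = (λ_ (T.obj A)).hom
  mul_unit : ∀ A : C, (T.obj A ◁ unit A) ≫ mul A = (ρ_ (T.obj A)).hom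
  mul_comm : ∀ A : C, (β_ (T.obj A) (T.obj A)).hom ≫ mul A = mul A
  monad_mul : ∀ A : C, mul (T.obj A) ≫ T.μ.app A = (T.μ.app A ⊗ₘ T.μ.app A) ≫ mul A

variable [Preadditive C] [MonoidalPreadditive C]

/-- `(T, ∇, u, Δ, e)` is a bialgebra modality (in the dual sense, for an algebra modality `T`):
each `T A` is moreover, naturally in `A`, a cocommutative comonoid and a bialgebra, and the unit of
the monad `T` is primitive with respect to `Δ`. -/
structure IsBialgebraModality (T : Monad C) (mul : ∀ A : C, T.obj A ⊗ T.obj A ⟶ T.obj A)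
    (unit : ∀ A : C, 𝟙_ C ⟶ T.obj A) (comul : ∀ A : C, T.obj A ⟶ T.obj A ⊗ T.obj A)
    (counit : ∀ A : C, T.obj A ⟶ 𝟙_ C) : Prop extends IsAlgebraModality T mul unit where
  comul_natural : ∀ {A B : C} (f : A ⟶ B), T.map f ≫ comul B = comul A ≫ (T.map f ⊗ₘ T.map f)
  counit_natural : ∀ {A B : C} (f : A ⟶ B), T.map f ≫ counit B = counit A
  comul_assoc : ∀ A : C, comul A ≫ (comul A ▷ T.obj A) ≫
    (α_ (T.obj A) (T.obj A) (T.obj A)).hom = comul A ≫ (T.obj A ◁ comul A)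
  comul_counit_left : ∀ A : C, comul A ≫ (counit A ▷ T.obj A) = (λ_ (T.obj A)).inv
  comul_counit_right : ∀ A : C, comul A ≫ (T.obj A ◁ counit A) = (ρ_ (T.obj A)).inv
  comul_comm : ∀ A : C, comul A ≫ (β_ (T.obj A) (T.obj A)).hom = comul A
  mul_counit : ∀ A : C, mul A ≫ counit A = (counit A ⊗ₘ counit A) ≫ (λ_ (𝟙_ C)).hom
  unit_comul : ∀ A : C, unit A ≫ comul A = (λ_ (𝟙_ C)).inv ≫ (unit A ⊗ₘ unit A)
  unit_counit : ∀ A : C, unit A ≫ counit A = 𝟙 (𝟙_ C)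
  mul_comul : ∀ A : C, mul A ≫ comul A =
    (comul A ⊗ₘ comul A) ≫ tensorμ (T.obj A) (T.obj A) (T.obj A) (T.obj A) ≫ (mul A ⊗ₘ mul A)
  monad_unit_comul : ∀ A : C, T.η.app A ≫ comul A =
    (ρ_ A).inv ≫ (T.η.app A ⊗ₘ unit A) + (λ_ A).inv ≫ (unit A ⊗ₘ T.η.app A)

/-- A bialgebra modality is additive if it turns sums and zeros of maps into bialgebra
convolutions. -/
structure IsAdditiveBialgebraModality (T : Monad C)
    (mul : ∀ A : C, T.obj A ⊗ T.obj A ⟶ T.obj A)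
    (unit : ∀ A : C, 𝟙_ C ⟶ T.obj A) (comul : ∀ A : C, T.obj A ⟶ T.obj A ⊗ T.obj A)
    (counit : ∀ A : C, T.obj A ⟶ 𝟙_ C) : Prop
    extends IsBialgebraModality T mul unit comul counit where
  map_add : ∀ {A B : C} (f g : A ⟶ B),
    T.map (f + g) = comul A ≫ (T.map f ⊗ₘ T.map g) ≫ mul B
  map_zero : ∀ A B : C, T.map (0 : A ⟶ B) = counit A ≫ unit B

/-- `d : T A ⟶ T A ⊗ A` is a deriving transformation (in the dual sense, for the algebra modality
`(T, ∇, u)`): it is natural and satisfies the constant, Leibniz, linear, chain and interchange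
rules. -/
structure IsDerivingTransformation (T : Monad C) (mul : ∀ A : C, T.obj A ⊗ T.obj A ⟶ T.obj A)
    (unit : ∀ A : C, 𝟙_ C ⟶ T.obj A) (d : ∀ A : C, T.obj A ⟶ T.obj A ⊗ A) : Prop where
  natural : ∀ {A B : C} (f : A ⟶ B), T.map f ≫ d B = d A ≫ (T.map f ⊗ₘ f)
  constant : ∀ A : C, unit A ≫ d A = 0
  leibniz : ∀ A : C, mul A ≫ d A =
    (T.obj A ◁ d A) ≫ (α_ (T.obj A) (T.obj A) A).inv ≫ (mul A ▷ A) +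
    (d A ▷ T.obj A) ≫ (α_ (T.obj A) A (T.obj A)).hom ≫ (T.obj A ◁ (β_ A (T.obj A)).hom) ≫
      (α_ (T.obj A) (T.obj A) A).inv ≫ (mul A ▷ A)
  linear : ∀ A : C, T.η.app A ≫ d A = (λ_ A).inv ≫ (unit A ▷ A)
  chain : ∀ A : C, T.μ.app A ≫ d A =
    d (T.obj A) ≫ (T.μ.app A ⊗ₘ d A) ≫ (α_ (T.obj A) (T.obj A) A).inv ≫ (mul A ▷ A)
  interchange : ∀ A : C, d A ≫ (d A ▷ A) ≫ (α_ (T.obj A) A A).hom ≫ (T.obj A ◁ (β_ A A).hom) ≫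
    (α_ (T.obj A) A A).inv = d A ≫ (d A ▷ A)

end Modalities

noncomputable section

/-! ### Commutative differential algebras -/

/-- A commutative differential `R`-algebra: a commutative `R`-algebra with an `R`-linear
derivation. -/
structure CommDiffAlg (R : Type u) [CommRing R] where
  carrier : Type u
  [commRing : CommRing carrier]
  [algebra : Algebra R carrier]
  D : Derivation R carrier carrier

namespace CommDiffAlg

variable {R : Type u} [CommRing R]

attribute [instance] CommDiffAlg.commRing CommDiffAlg.algebra

/-- Maps of differential algebras: algebra morphisms commuting with the derivations. -/
@[ext]
structure Hom (A B : CommDiffAlg R) where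
  toAlgHom : A.carrier →ₐ[R] B.carrier
  comm : ∀ a : A.carrier, toAlgHom (A.D a) = B.D (toAlgHom a)

instance : Category (CommDiffAlg R) where
  Hom A B := Hom A B
  id A := ⟨AlgHom.id R A.carrier, fun _ => rfl⟩
  comp f g := ⟨g.toAlgHom.comp f.toAlgHom, fun a => by simp [f.comm, g.comm]⟩

variable (R) in
/-- The forgetful functor to `R`-modules. -/
def forgetToModule : CommDiffAlg R ⥤ ModuleCat.{u} R where
  obj A := ModuleCat.of R A.carrier
  map f := ModuleCat.ofHom (Hom.toAlgHom f).toLinearMap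

end CommDiffAlg

/-! ### The free differential algebra `Sym(⨁ₙ M)` -/

section Free

variable (R : Type u) [CommRing R]

section Modules

variable (M : Type u) [AddCommGroup M] [Module R M]

/-- The extension of a linear map `f : V → Sym(V)` to an algebra map
`Sym(V) → Sym(V)[ε]`, `v ↦ v + f(v) ε`. -/
def symDualNumber {V : Type u} [AddCommGroup V] [Module R V] (f : V →ₗ[R] SymmetricAlgebra R V) :
    SymmetricAlgebra R V →ₐ[R] DualNumber (SymmetricAlgebra R V) :=
  SymmetricAlgebra.lift
    ((TrivSqZeroExt.inlAlgHom R (SymmetricAlgebra R V) (SymmetricAlgebra R V)).toLinearMap ∘ₗ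
        SymmetricAlgebra.ι R V +
      (TrivSqZeroExt.inrHom (SymmetricAlgebra R V) (SymmetricAlgebra R V)).restrictScalars R ∘ₗ f)

theorem fst_symDualNumber {V : Type u} [AddCommGroup V] [Module R V]
    (f : V →ₗ[R] SymmetricAlgebra R V) (a : SymmetricAlgebra R V) :
    (symDualNumber R f a).fst = a := by
  have h : (TrivSqZeroExt.fstHom R (SymmetricAlgebra R V) (SymmetricAlgebra R V)).comp
      (symDualNumber R f) = AlgHom.id R _ := by
    apply SymmetricAlgebra.algHom_ext
    ext v
    simp [symDualNumber]
  exact congr($h a)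

/-- The derivation of `Sym(V)` whose restriction to `V` is the linear map `f : V → Sym(V)`. -/
def symDerivation {V : Type u} [AddCommGroup V] [Module R V] (f : V →ₗ[R] SymmetricAlgebra R V) :
    Derivation R (SymmetricAlgebra R V) (SymmetricAlgebra R V) :=
  Derivation.mk'
    ((TrivSqZeroExt.sndHom (SymmetricAlgebra R V) (SymmetricAlgebra R V)).restrictScalars R ∘ₗ
      (symDualNumber R f).toLinearMap)
    (fun a b => by simp [fst_symDualNumber, mul_comm])

@[simp]
theorem symDerivation_ι {V : Type u} [AddCommGroup V] [Module R V]
    (f : V →ₗ[R] SymmetricAlgebra R V) (v : V) :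
    symDerivation R f (SymmetricAlgebra.ι R V v) = f v := by
  simp [symDerivation, symDualNumber]

/-- The carrier `Diff(M) = Sym(⨁_{n ∈ ℕ} M)`. -/
abbrev DiffCarrier : Type u := SymmetricAlgebra R (⨁ _ : ℕ, M)

/-- The shift `⨁ₙ M → ⨁ₙ M`, which maps the `n`-th summand identically onto the `(n+1)`-st. -/
def diffShift : (⨁ _ : ℕ, M) →ₗ[R] (⨁ _ : ℕ, M) :=
  DirectSum.toModule R ℕ _ fun n => DirectSum.lof R ℕ (fun _ => M) (n + 1)

/-- The differential `D` of `Diff(M)`: the derivation extending the shift. -/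
def diffD : Derivation R (DiffCarrier R M) (DiffCarrier R M) :=
  symDerivation R (SymmetricAlgebra.ι R _ ∘ₗ diffShift R M)

end Modules

/-- `Sym(⨁ₙ f)` for a linear map `f`. -/
def diffMap {M N : Type u} [AddCommGroup M] [Module R M] [AddCommGroup N] [Module R N]
    (f : M →ₗ[R] N) : DiffCarrier R M →ₐ[R] DiffCarrier R N :=
  SymmetricAlgebra.lift (SymmetricAlgebra.ι R _ ∘ₗ DirectSum.lmap fun _ : ℕ => f)

theorem diffMap_diffD {M N : Type u} [AddCommGroup M] [Module R M] [AddCommGroup N] [Module R N]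
    (f : M →ₗ[R] N) (a : DiffCarrier R M) :
    diffMap R f (diffD R M a) = diffD R N (diffMap R f a) := by
  have key : ∀ v : (⨁ _ : ℕ, M), DirectSum.lmap (fun _ : ℕ => f) (diffShift R M v) =
      diffShift R N (DirectSum.lmap (fun _ : ℕ => f) v) := by
    intro v
    have h : (DirectSum.lmap (fun _ : ℕ => f)) ∘ₗ diffShift R M =
        diffShift R N ∘ₗ DirectSum.lmap (fun _ : ℕ => f) := by
      ext n x : 2
      simp [diffShift, DirectSum.toModule_lof, DirectSum.lmap_lof]
    exact congr($h v)
  induction a using SymmetricAlgebra.induction with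
  | algebraMap r => simp
  | ι v => simp [diffD, diffMap, key]
  | mul a b ha hb => simp [ha, hb]
  | add a b ha hb => simp [ha, hb]

theorem diffMap_id (M : Type u) [AddCommGroup M] [Module R M] :
    diffMap R (LinearMap.id : M →ₗ[R] M) = AlgHom.id R _ := by
  apply SymmetricAlgebra.algHom_ext
  ext v : 1
  simp [diffMap]

theorem diffMap_comp {M N P : Type u} [AddCommGroup M] [Module R M] [AddCommGroup N] [Module R N]
    [AddCommGroup P] [Module R P] (g : N →ₗ[R] P) (f : M →ₗ[R] N) :
    diffMap R (g ∘ₗ f) = (diffMap R g).comp (diffMap R f) := by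
  apply SymmetricAlgebra.algHom_ext
  refine LinearMap.ext fun v => ?_
  simp [diffMap]

/-- The free commutative differential algebra functor `M ↦ (Sym(⨁ₙ M), D)`. -/
def freeCommDiffAlg : ModuleCat.{u} R ⥤ CommDiffAlg R where
  obj M := { carrier := DiffCarrier R M, D := diffD R M }
  map f := ⟨diffMap R f.hom, diffMap_diffD R f.hom⟩
  map_id M := CommDiffAlg.Hom.ext (diffMap_id R M)
  map_comp f g := CommDiffAlg.Hom.ext (diffMap_comp R g.hom f.hom)

/-- The endofunctor `Diff` of the category of `R`-modules underlying the free differential algebra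
modality. -/
abbrev diffFunctor : ModuleCat.{u} R ⥤ ModuleCat.{u} R :=
  freeCommDiffAlg R ⋙ CommDiffAlg.forgetToModule R

/-! ### The structure maps of `Diff` -/

variable (M : ModuleCat.{u} R)

/-- `α : M → Diff(M)`, the inclusion of the zeroth summand followed by the inclusion into the
symmetric algebra. -/
def diffEta : M ⟶ (diffFunctor R).obj M :=
  ModuleCat.ofHom (SymmetricAlgebra.ι R _ ∘ₗ DirectSum.lof R ℕ (fun _ => (M : Type u)) 0)

/-- For a differential algebra `(A, D)`, the map `ψ : ⨁ₙ A → A` that is `Dⁿ` on the `n`-th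
summand. -/
def diffPsi (A : CommDiffAlg R) : (⨁ _ : ℕ, A.carrier) →ₗ[R] A.carrier :=
  DirectSum.toModule R ℕ _ fun n => (A.D : A.carrier →ₗ[R] A.carrier) ^ n

/-- `ν : Diff(Diff(M)) → Diff(M)`, namely `Sym(ψ) : Sym(⨁ₙ Diff(M)) → Sym(Diff(M))` followed by
the multiplication `Sym(Sym(⨁ₙ M)) → Sym(⨁ₙ M)` of the symmetric algebra monad. -/
def diffMu : (diffFunctor R).obj ((diffFunctor R).obj M) ⟶ (diffFunctor R).obj M :=
  ModuleCat.ofHom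
    ((SymmetricAlgebra.lift (LinearMap.id : DiffCarrier R M →ₗ[R] DiffCarrier R M)).comp
      (SymmetricAlgebra.lift
        (SymmetricAlgebra.ι R (DiffCarrier R M) ∘ₗ
          diffPsi R ((freeCommDiffAlg R).obj M)))).toLinearMap

/-- `∇`, the multiplication of the symmetric algebra. -/
def diffMul : (diffFunctor R).obj M ⊗ (diffFunctor R).obj M ⟶ (diffFunctor R).obj M :=
  ModuleCat.ofHom (LinearMap.mul' R (DiffCarrier R M))

/-- `u`, the unit of the symmetric algebra. -/
def diffUnit : 𝟙_ (ModuleCat.{u} R) ⟶ (diffFunctor R).obj M :=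
  ModuleCat.ofHom (Algebra.linearMap R (DiffCarrier R M))

/-- `Δ`, the comultiplication of the symmetric algebra: the algebra map with
`Δ(v) = v ⊗ 1 + 1 ⊗ v` on generators. -/
def diffComul : (diffFunctor R).obj M ⟶ (diffFunctor R).obj M ⊗ (diffFunctor R).obj M :=
  ModuleCat.ofHom (Coalgebra.comul (R := R) (A := DiffCarrier R M))

/-- `e`, the counit of the symmetric algebra: the algebra map that vanishes on generators. -/
def diffCounit : (diffFunctor R).obj M ⟶ 𝟙_ (ModuleCat.{u} R) :=
  ModuleCat.ofHom (Coalgebra.counit (R := R) (A := DiffCarrier R M))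

end Free

end

/-! `Diff(M)` is generated as an algebra by the derivatives `diffGen n x`, and `D` raises `n` by
one. Hence a linear map `f` into a differential algebra extends uniquely, by sending `diffGen n x`
to `Dⁿ (f x)`. The modality axioms compare algebra maps on these generators or come from the Hopf
structure of the symmetric algebra.

The obstruction is that `D` is linear in its argument, which the chain rule transfers to `b`, while
`D` of a product needs two terms. Pair `b` at `R²` with an algebra map `φ` and the second coordinate
to get a functional `∂` with `∂(ac) = φ(a)∂c + φ(c)∂a`. Naturality and the chain rule show that `∂a
= 0` forces `∂(Da) = 0` (`derivingPairing_diffD`). Let `x`, `y` be the degree-zero generators of the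
two basis vectors, and let `φ` send `Dx` to `1` and the generators `x`, `y`, `Dy` to `0`. Then
`∂(xy) = 0`, but `∂(D(xy)) = φ(Dx)∂y = 1`. So `1 = 0`, and every module is zero. -/

noncomputable section

open scoped TensorProduct

section

variable (R : Type u) [CommRing R]

/-! ### Universal property of the free differential algebra. -/

section

variable (M : Type u) [AddCommGroup M] [Module R M]

/-- The `n`-th derivative of the generator `x` of `Diff(M)`. -/
def diffGen (n : ℕ) : M →ₗ[R] DiffCarrier R M :=
  SymmetricAlgebra.ι R _ ∘ₗ DirectSum.lof R ℕ (fun _ => M) n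

variable {M}

theorem diffD_diffGen (n : ℕ) (x : M) :
    diffD R M (diffGen R M n x) = diffGen R M (n + 1) x := by
  simp [diffD, diffGen, diffShift, DirectSum.toModule_lof]

theorem diffCarrier_algHom_ext {A : Type*} [CommSemiring A] [Algebra R A]
    {f g : DiffCarrier R M →ₐ[R] A}
    (h : ∀ n x, f (diffGen R M n x) = g (diffGen R M n x)) : f = g := by
  apply SymmetricAlgebra.algHom_ext
  ext n x : 2
  exact h n x

theorem diffMap_diffGen {N : Type u} [AddCommGroup N] [Module R N] (f : M →ₗ[R] N)
    (n : ℕ) (x : M) : diffMap R f (diffGen R M n x) = diffGen R N n (f x) := by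
  simp [diffMap, diffGen, DirectSum.lmap_lof]

theorem comul_diffGen (n : ℕ) (x : M) :
    Coalgebra.comul (R := R) (diffGen R M n x) =
      TensorProduct.tmul R (diffGen R M n x) 1 + TensorProduct.tmul R 1 (diffGen R M n x) :=
  SymmetricAlgebra.comul_ι R _ _

theorem counit_diffGen (n : ℕ) (x : M) :
    Coalgebra.counit (R := R) (diffGen R M n x) = 0 :=
  SymmetricAlgebra.counit_ι R _ _

/-- The algebra map `Diff(M) → A` extending a linear map from `M` to a differential algebra. -/
def diffLift (A : CommDiffAlg R) (f : M →ₗ[R] A.carrier) : DiffCarrier R M →ₐ[R] A.carrier :=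
  SymmetricAlgebra.lift
    (DirectSum.toModule R ℕ _ fun n => ((A.D : A.carrier →ₗ[R] A.carrier) ^ n) ∘ₗ f)

theorem diffLift_diffGen (A : CommDiffAlg R) (f : M →ₗ[R] A.carrier) (n : ℕ) (x : M) :
    diffLift R A f (diffGen R M n x) = ((A.D : A.carrier →ₗ[R] A.carrier) ^ n) (f x) := by
  simp [diffLift, diffGen, DirectSum.toModule_lof]

/-- Both sides obey the same Leibniz rule along `diffLift`, so only generators matter; there,
applying `D` adds one to the exponent. -/
theorem diffLift_diffD (A : CommDiffAlg R) (f : M →ₗ[R] A.carrier) (a : DiffCarrier R M) :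
    diffLift R A f (diffD R M a) = A.D (diffLift R A f a) := by
  induction a using SymmetricAlgebra.induction with
  | algebraMap r => simp
  | ι v =>
    induction v using DirectSum.induction_on with
    | zero => simp
    | of n x =>
      have h := diffLift_diffGen R A f
      change diffLift R A f (diffD R M (diffGen R M n x)) = A.D (diffLift R A f (diffGen R M n x))
      rw [diffD_diffGen, h, h, pow_succ']
      rfl
    | add v w hv hw => simp only [map_add, hv, hw]
  | mul a b ha hb => simp [ha, hb]
  | add a b ha hb => simp [ha, hb]

/-- Every generator is an iterated derivative of one in degree zero, so commuting with `D` leaves no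
freedom beyond degree zero. -/
theorem diffLift_unique (A : CommDiffAlg R) (g : DiffCarrier R M →ₐ[R] A.carrier)
    (hg : ∀ a, g (diffD R M a) = A.D (g a)) :
    diffLift R A (g.toLinearMap ∘ₗ diffGen R M 0) = g := by
  apply diffCarrier_algHom_ext
  intro n x
  rw [diffLift_diffGen]
  induction n with
  | zero => rfl
  | succ n ih =>
    rw [pow_succ', ← diffD_diffGen, hg, ← ih]
    rfl

theorem diffLift_comp {N : Type u} [AddCommGroup N] [Module R N] (A : CommDiffAlg R)
    (g : N →ₗ[R] A.carrier) (f : M →ₗ[R] N) :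
    diffLift R A (g ∘ₗ f) = (diffLift R A g).comp (diffMap R f) := by
  apply diffCarrier_algHom_ext
  intro n x
  rw [AlgHom.comp_apply, diffMap_diffGen, diffLift_diffGen, diffLift_diffGen]
  rfl

end

/-! ### The adjunction and its monad. -/

/-- `Diff` is left adjoint to the forgetful functor from differential algebras to modules. -/
def diffAdjunction : freeCommDiffAlg R ⊣ CommDiffAlg.forgetToModule R :=
  Adjunction.mkOfHomEquiv
    { homEquiv M A :=
        { toFun g := ModuleCat.ofHom ((CommDiffAlg.Hom.toAlgHom g).toLinearMap ∘ₗ diffGen R M 0)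
          invFun f := ⟨diffLift R A f.hom, diffLift_diffD R A f.hom⟩
          left_inv g :=
            CommDiffAlg.Hom.ext (diffLift_unique R A (CommDiffAlg.Hom.toAlgHom g) g.comm)
          right_inv f := by
            ext x
            exact diffLift_diffGen R A f.hom 0 x }
      homEquiv_naturality_left_symm f g :=
        CommDiffAlg.Hom.ext (diffLift_comp R _ g.hom f.hom)
      homEquiv_naturality_right f g := rfl }

theorem diffAdjunction_unit (M : ModuleCat.{u} R) :
    (diffAdjunction R).toMonad.η.app M = diffEta R M :=
  rfl

/-- The multiplication of the monad `Diff`, as an algebra map. -/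
def diffMuAlgHom (M : Type u) [AddCommGroup M] [Module R M] :
    DiffCarrier R (DiffCarrier R M) →ₐ[R] DiffCarrier R M :=
  diffLift R ⟨DiffCarrier R M, diffD R M⟩ LinearMap.id

theorem diffPsi_lof (A : CommDiffAlg R) (n : ℕ) (x : A.carrier) :
    diffPsi R A (DirectSum.lof R ℕ (fun _ => A.carrier) n x) =
      ((A.D : A.carrier →ₗ[R] A.carrier) ^ n) x := by
  simp [diffPsi, DirectSum.toModule_lof]

/-- The adjunction yields the multiplication as the lift of the identity. Both algebra maps send the
`n`-th generator of `x` to `Dⁿ x`. -/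
theorem diffMu_eq (M : ModuleCat.{u} R) :
    diffMu R M = ModuleCat.ofHom (diffMuAlgHom R M).toLinearMap := by
  have h : (SymmetricAlgebra.lift (LinearMap.id : DiffCarrier R M →ₗ[R] DiffCarrier R M)).comp
      (SymmetricAlgebra.lift
        (SymmetricAlgebra.ι R (DiffCarrier R M) ∘ₗ
          diffPsi R ((freeCommDiffAlg R).obj M))) = diffMuAlgHom R M := by
    refine diffCarrier_algHom_ext (M := DiffCarrier R M) R fun n x => ?_
    refine Eq.trans ?_ (diffLift_diffGen R ⟨DiffCarrier R M, diffD R M⟩ LinearMap.id n x).symm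
    refine (congrArg (SymmetricAlgebra.lift (LinearMap.id : DiffCarrier R M →ₗ[R] _))
      (SymmetricAlgebra.lift_ι_apply _ _)).trans ?_
    refine (SymmetricAlgebra.lift_ι_apply _ _).trans ?_
    exact diffPsi_lof R ((freeCommDiffAlg R).obj M) n x
  exact congrArg (fun f : _ →ₐ[R] _ => ModuleCat.ofHom f.toLinearMap) h

theorem diffAdjunction_mu (M : ModuleCat.{u} R) :
    (diffAdjunction R).toMonad.μ.app M = diffMu R M :=
  (diffMu_eq R M).symm

/-! ### The additive bialgebra modality. -/

theorem comul_diffMap {M N : Type u} [AddCommGroup M] [Module R M] [AddCommGroup N] [Module R N]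
    (f : M →ₗ[R] N) (a : DiffCarrier R M) :
    Coalgebra.comul (R := R) (diffMap R f a) =
      TensorProduct.map (diffMap R f).toLinearMap (diffMap R f).toLinearMap
        (Coalgebra.comul (R := R) a) := by
  have h : (Bialgebra.comulAlgHom R (DiffCarrier R N)).comp (diffMap R f) =
      (Algebra.TensorProduct.map (diffMap R f) (diffMap R f)).comp
        (Bialgebra.comulAlgHom R (DiffCarrier R M)) := by
    apply diffCarrier_algHom_ext
    intro n x
    simp [diffMap_diffGen, comul_diffGen]
  exact congr($h a)

theorem counit_diffMap {M N : Type u} [AddCommGroup M] [Module R M] [AddCommGroup N] [Module R N]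
    (f : M →ₗ[R] N) (a : DiffCarrier R M) :
    Coalgebra.counit (R := R) (diffMap R f a) = Coalgebra.counit (R := R) a := by
  have h : (Bialgebra.counitAlgHom R (DiffCarrier R N)).comp (diffMap R f) =
      Bialgebra.counitAlgHom R (DiffCarrier R M) := by
    apply diffCarrier_algHom_ext
    intro n x
    simp only [AlgHom.comp_apply, diffMap_diffGen, Bialgebra.counitAlgHom_apply, counit_diffGen]
  exact congr($h a)

/-- Multiplication on a commutative algebra is an algebra map, so the convolution is one too; since
generators are primitive, it adds the two maps there. -/
theorem diffMap_add {M N : Type u} [AddCommGroup M] [Module R M] [AddCommGroup N] [Module R N]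
    (f g : M →ₗ[R] N) (a : DiffCarrier R M) :
    diffMap R (f + g) a = LinearMap.mul' R (DiffCarrier R N)
      (TensorProduct.map (diffMap R f).toLinearMap (diffMap R g).toLinearMap
        (Coalgebra.comul (R := R) a)) := by
  have h : diffMap R (f + g) =
      ((Algebra.TensorProduct.lmul' R).comp
        (Algebra.TensorProduct.map (diffMap R f) (diffMap R g))).comp
        (Bialgebra.comulAlgHom R (DiffCarrier R M)) := by
    apply diffCarrier_algHom_ext
    intro n x
    simp [diffMap_diffGen, comul_diffGen]
  exact congr($h a)

theorem diffMap_zero {M N : Type u} [AddCommGroup M] [Module R M] [AddCommGroup N] [Module R N]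
    (a : DiffCarrier R M) :
    diffMap R (0 : M →ₗ[R] N) a = algebraMap R _ (Coalgebra.counit (R := R) a) := by
  have h : diffMap R (0 : M →ₗ[R] N) =
      (Algebra.ofId R (DiffCarrier R N)).comp (Bialgebra.counitAlgHom R (DiffCarrier R M)) := by
    apply diffCarrier_algHom_ext
    intro n x
    simp only [AlgHom.comp_apply, diffMap_diffGen, Bialgebra.counitAlgHom_apply, counit_diffGen]
    simp
  exact congr($h a)

/-- Translates the product of the tensor product algebra into the middle-four interchange used by
the categorical bialgebra axiom. -/
theorem tensorProduct_mul_eq {A B : Type*} [CommRing A] [Algebra R A] [CommRing B] [Algebra R B]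
    (s t : A ⊗[R] B) :
    s * t = TensorProduct.map (LinearMap.mul' R A) (LinearMap.mul' R B)
      (TensorProduct.tensorTensorTensorComm R A B A B (s ⊗ₜ[R] t)) := by
  induction s with
  | zero => simp
  | add s s' hs hs' => simp only [add_mul, hs, hs', TensorProduct.add_tmul, map_add]
  | tmul a b =>
    induction t with
    | zero => simp
    | add t t' ht ht' => simp only [mul_add, ht, ht', TensorProduct.tmul_add, map_add]
    | tmul c d => simp

theorem diff_isAlgebraModality :
    IsAlgebraModality (diffAdjunction R).toMonad (diffMul R) (diffUnit R) where
  mul_natural f := ModuleCat.hom_ext <| TensorProduct.ext' fun a b =>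
    ((diffMap R f.hom).map_mul' a b).symm
  unit_natural f := ModuleCat.hom_ext <| LinearMap.ext fun r =>
    (diffMap R f.hom).commutes r
  mul_assoc A := ModuleCat.hom_ext <| TensorProduct.ext_threefold fun a b c =>
    mul_assoc (G := DiffCarrier R A) a b c
  unit_mul A := ModuleCat.hom_ext <| TensorProduct.ext' fun r a =>
    (Algebra.smul_def (A := DiffCarrier R A) r a).symm
  mul_unit A := ModuleCat.hom_ext <| TensorProduct.ext' fun a r =>
    (_root_.mul_comm (G := DiffCarrier R A) _ _).trans
      (Algebra.smul_def (A := DiffCarrier R A) r a).symm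
  mul_comm A := ModuleCat.hom_ext <| TensorProduct.ext' fun a b =>
    _root_.mul_comm (G := DiffCarrier R A) b a
  monad_mul A := ModuleCat.hom_ext <| TensorProduct.ext' fun a b =>
    (diffMuAlgHom R A).map_mul' a b

theorem diff_isBialgebraModality :
    IsBialgebraModality (diffAdjunction R).toMonad (diffMul R) (diffUnit R)
      (diffComul R) (diffCounit R) where
  toIsAlgebraModality := diff_isAlgebraModality R
  comul_natural f := ModuleCat.hom_ext <| LinearMap.ext fun a =>
    comul_diffMap R f.hom a
  counit_natural f := ModuleCat.hom_ext <| LinearMap.ext fun a =>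
    counit_diffMap R f.hom a
  comul_assoc A := ModuleCat.hom_ext <|
    Coalgebra.coassoc (R := R) (A := DiffCarrier R A)
  comul_counit_left A := ModuleCat.hom_ext <|
    Coalgebra.rTensor_counit_comp_comul (R := R) (A := DiffCarrier R A)
  comul_counit_right A := ModuleCat.hom_ext <|
    Coalgebra.lTensor_counit_comp_comul (R := R) (A := DiffCarrier R A)
  comul_comm A := ModuleCat.hom_ext <|
    Coalgebra.comm_comp_comul (R := R) (A := DiffCarrier R A)
  mul_counit A := ModuleCat.hom_ext <| TensorProduct.ext' fun a b =>
    Bialgebra.counit_mul (R := R) (A := DiffCarrier R A) a b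
  unit_comul A := ModuleCat.hom_ext <| LinearMap.ext_ring <| by
    change Coalgebra.comul (R := R) (algebraMap R (DiffCarrier R A) 1) =
      algebraMap R (DiffCarrier R A) 1 ⊗ₜ[R] algebraMap R (DiffCarrier R A) 1
    rw [map_one, Bialgebra.comul_one]
    rfl
  unit_counit A := ModuleCat.hom_ext <| LinearMap.ext fun r =>
    Bialgebra.counit_algebraMap (A := DiffCarrier R A) r
  mul_comul A := ModuleCat.hom_ext <| TensorProduct.ext' fun a b => by
    rw [ModuleCat.MonoidalCategory.tensorμ_eq_tensorTensorTensorComm]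
    refine (Bialgebra.comul_mul (R := R) (A := DiffCarrier R A) a b).trans ?_
    exact tensorProduct_mul_eq R _ _
  monad_unit_comul A := ModuleCat.hom_ext <| LinearMap.ext fun x =>
    comul_diffGen R 0 x

theorem diff_isAdditiveBialgebraModality :
    IsAdditiveBialgebraModality (diffAdjunction R).toMonad (diffMul R) (diffUnit R)
      (diffComul R) (diffCounit R) where
  toIsBialgebraModality := diff_isBialgebraModality R
  map_add f g := ModuleCat.hom_ext <| LinearMap.ext fun a =>
    diffMap_add R f.hom g.hom a
  map_zero _ _ := ModuleCat.hom_ext <| LinearMap.ext fun a =>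
    diffMap_zero R a

/-! ### The obstruction to a deriving transformation. -/

/-- The algebra map `Diff(R²) → R` that sends the first derivative of the first basis vector to `1`
and all other generators to `0`. -/
def firstDerivEval : DiffCarrier R (R × R) →ₐ[R] R :=
  SymmetricAlgebra.lift
    (DirectSum.toModule R ℕ _ fun n => if n = 1 then LinearMap.fst R R R else 0)

theorem firstDerivEval_diffGen (n : ℕ) (v : R × R) :
    firstDerivEval R (diffGen R (R × R) n v) = if n = 1 then v.1 else 0 := by
  simp only [firstDerivEval, diffGen, LinearMap.comp_apply, SymmetricAlgebra.lift_ι_apply,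
    DirectSum.toModule_lof]
  split_ifs <;> rfl

section Pairing

variable {R} {A V : Type*} [CommRing A] [Algebra R A] [AddCommGroup V] [Module R V]
  (φ : A →ₐ[R] R) (l : V →ₗ[R] R)

/-- The functional `a ⊗ v ↦ φ(a) l(v)` on `A ⊗ V`. -/
def algPairing : A ⊗[R] V →ₗ[R] R :=
  LinearMap.mul' R R ∘ₗ TensorProduct.map φ.toLinearMap l

theorem algPairing_tmul (a : A) (v : V) : algPairing φ l (a ⊗ₜ v) = φ a * l v := rfl

/-- With `algPairing_mul_right`, evaluates the two summands of the Leibniz rule; multiplicativity of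
`φ` pulls the extra factor out. -/
theorem algPairing_mul_left (a : A) (t : A ⊗[R] V) :
    algPairing φ l ((LinearMap.mul' R A).rTensor V ((TensorProduct.assoc R _ _ _).symm (a ⊗ₜ t))) =
      φ a * algPairing φ l t := by
  induction t with
  | zero => simp
  | add s t hs ht => simp only [TensorProduct.tmul_add, map_add, hs, ht, mul_add]
  | tmul c v => simp [algPairing_tmul, mul_assoc]

theorem algPairing_mul_right (t : A ⊗[R] V) (a : A) :
    algPairing φ l ((LinearMap.mul' R A).rTensor V ((TensorProduct.assoc R _ _ _).symm
      ((TensorProduct.comm R V A).toLinearMap.lTensor A (TensorProduct.assoc R _ _ _ (t ⊗ₜ a))))) =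
      φ a * algPairing φ l t := by
  induction t with
  | zero => simp
  | add s t hs ht => simp only [TensorProduct.add_tmul, map_add, hs, ht, mul_add]
  | tmul c v =>
    simp [algPairing_tmul]
    ring

/-- The shape of the chain rule after naturality: `φ` factors out of each pure tensor, leaving a
pairing that vanishes on the image of `g`. -/
theorem algPairing_mul_map_map_eq_zero {P Q P' Q' : Type*} [AddCommGroup P] [Module R P]
    [AddCommGroup Q] [Module R Q] [AddCommGroup P'] [Module R P'] [AddCommGroup Q'] [Module R Q']
    (f : P →ₗ[R] A) (d : Q →ₗ[R] A ⊗[R] V) (f' : P' →ₗ[R] P) (g : Q' →ₗ[R] Q)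
    (hd : ∀ q, algPairing φ l (d (g q)) = 0) (t : P' ⊗[R] Q') :
    algPairing φ l ((LinearMap.mul' R A).rTensor V ((TensorProduct.assoc R _ _ _).symm
      (TensorProduct.map f d (TensorProduct.map f' g t)))) = 0 := by
  induction t with
  | zero => simp
  | add s t hs ht => simp only [map_add, hs, ht, add_zero]
  | tmul p q =>
    rw [TensorProduct.map_tmul, TensorProduct.map_tmul, algPairing_mul_left, hd, mul_zero]

end Pairing

variable {R} in
/-- A family of maps `Diff(M) → Diff(M) ⊗ M` at `M = R²`, followed by `firstDerivEval` on the first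
factor and the second coordinate on the second one. -/
def derivingPairing
    (b : ∀ M : ModuleCat.{u} R, (diffFunctor R).obj M ⟶ (diffFunctor R).obj M ⊗ M) :
    DiffCarrier R (R × R) →ₗ[R] R :=
  algPairing (firstDerivEval R) (LinearMap.snd R R R) ∘ₗ (b (ModuleCat.of R (R × R))).hom

section Deriving

variable {R}
variable {b : ∀ M : ModuleCat.{u} R, (diffFunctor R).obj M ⟶ (diffFunctor R).obj M ⊗ M}
  (hb : IsDerivingTransformation (diffAdjunction R).toMonad (diffMul R) (diffUnit R) b)

include hb

theorem derivingPairing_mul (a c : DiffCarrier R (R × R)) :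
    derivingPairing b (a * c) = firstDerivEval R a * derivingPairing b c +
      firstDerivEval R c * derivingPairing b a := by
  have h := congr(($(hb.leibniz (ModuleCat.of R (R × R)))).hom (a ⊗ₜ[R] c))
  refine (congrArg (algPairing (firstDerivEval R) (LinearMap.snd R R R)) h).trans ?_
  refine (map_add (algPairing (firstDerivEval R) (LinearMap.snd R R R)) _ _).trans (congrArg₂ (· + ·) ?_ ?_)
  · exact algPairing_mul_left _ _ a _
  · exact algPairing_mul_right _ _ _ c

theorem derivingPairing_diffGen_zero (v : R × R) :
    derivingPairing b (diffGen R (R × R) 0 v) = v.2 := by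
  have h := congr(($(hb.linear (ModuleCat.of R (R × R)))).hom v)
  refine (congrArg (algPairing (firstDerivEval R) (LinearMap.snd R R R)) h).trans ?_
  refine (algPairing_tmul _ _ (algebraMap R _ 1) v).trans ?_
  simp

/-- Since `D a` is the monad multiplication of `diffGen 1 a`, the chain rule computes `b (D a)` from
`b (diffGen 1 a)`. By naturality the second tensor factor of the latter involves only multiples of
`a`, which the pairing kills. -/
theorem derivingPairing_diffD {a : DiffCarrier R (R × R)} (ha : derivingPairing b a = 0) :
    derivingPairing b (diffD R (R × R) a) = 0 := by
  -- The map `1 ↦ a` exhibits `diffGen 1 a` as the image of `diffGen 1 1` in `Diff(R)`.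
  let g : ModuleCat.of R R ⟶ ModuleCat.of R (DiffCarrier R (R × R)) :=
    ModuleCat.ofHom (LinearMap.toSpanSingleton R _ a)
  have hnat : (b (ModuleCat.of R (DiffCarrier R (R × R)))).hom (diffGen R _ 1 a) =
      TensorProduct.map (diffMap R g.hom).toLinearMap g.hom
        ((b (ModuleCat.of R R)).hom (diffGen R R 1 1)) := by
    have h := congr(($(hb.natural g)).hom (diffGen R R 1 1))
    refine Eq.trans ?_ h
    refine congrArg (b (ModuleCat.of R (DiffCarrier R (R × R)))).hom ?_
    refine Eq.trans ?_ (diffMap_diffGen R g.hom 1 1).symm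
    exact congrArg _ (one_smul R a).symm
  have hmu : diffMuAlgHom R (R × R) (diffGen R _ 1 a) = diffD R (R × R) a :=
    diffLift_diffGen R ⟨DiffCarrier R (R × R), diffD R (R × R)⟩ LinearMap.id 1 a
  have hchain := congr(($(hb.chain (ModuleCat.of R (R × R)))).hom (diffGen R _ 1 a))
  have hspan (r : R) : derivingPairing b (r • a) = 0 := by rw [map_smul, ha, smul_zero]
  have key := algPairing_mul_map_map_eq_zero (firstDerivEval R) (LinearMap.snd R R R)
    (diffMuAlgHom R (R × R)).toLinearMap (b (ModuleCat.of R (R × R))).hom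
    (diffMap R g.hom).toLinearMap g.hom hspan ((b (ModuleCat.of R R)).hom (diffGen R R 1 1))
  refine (congrArg (derivingPairing b) hmu).symm.trans ?_
  refine (congrArg (algPairing (firstDerivEval R) (LinearMap.snd R R R)) hchain).trans
    (Eq.trans ?_ key)
  exact congrArg (fun z => algPairing (firstDerivEval R) (LinearMap.snd R R R)
    ((LinearMap.mul' R (DiffCarrier R (R × R))).rTensor (R × R)
      ((TensorProduct.assoc R _ _ _).symm
        (TensorProduct.map (diffMuAlgHom R (R × R)).toLinearMap
          (b (ModuleCat.of R (R × R))).hom z)))) hnat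

theorem one_eq_zero_of_isDerivingTransformation : (1 : R) = 0 := by
  -- The product `xy` pairs to zero as `φ` kills both degree-zero generators; in `D(xy)` the sole
  -- surviving contribution is `φ(Dx)∂y = 1`.
  have h := derivingPairing_diffD hb
    (a := diffGen R (R × R) 0 (1, 0) * diffGen R (R × R) 0 (0, 1)) (by
      simp [derivingPairing_mul hb, firstDerivEval_diffGen])
  simpa [derivingPairing_mul hb, firstDerivEval_diffGen, diffD_diffGen,
    derivingPairing_diffGen_zero hb] using h

end Deriving

end

end

theorem mainTheorem9 (R : Type u) [CommRing R] :
    ∃ adj : freeCommDiffAlg R ⊣ CommDiffAlg.forgetToModule R,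
      (∀ M : ModuleCat.{u} R, adj.toMonad.η.app M = diffEta R M) ∧
      (∀ M : ModuleCat.{u} R, adj.toMonad.μ.app M = diffMu R M) ∧
      IsAdditiveBialgebraModality adj.toMonad
        (diffMul R) (diffUnit R) (diffComul R) (diffCounit R) ∧
      (∀ b : ∀ M : ModuleCat.{u} R, (diffFunctor R).obj M ⟶ (diffFunctor R).obj M ⊗ M,
        IsDerivingTransformation adj.toMonad (diffMul R) (diffUnit R) b →
          (∀ M : ModuleCat.{u} R, 𝟙 (M ⊗ M) = -(β_ M M).hom) ∧ (1 : R) = 0) ∧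
      (Nontrivial R →
        ¬ ∃ b : ∀ M : ModuleCat.{u} R, (diffFunctor R).obj M ⟶ (diffFunctor R).obj M ⊗ M,
          IsDerivingTransformation adj.toMonad (diffMul R) (diffUnit R) b) := by
  refine ⟨diffAdjunction R, diffAdjunction_unit R, diffAdjunction_mu R,
    diff_isAdditiveBialgebraModality R, fun b hb => ?_, fun hR => ?_⟩
  · have h := one_eq_zero_of_isDerivingTransformation hb
    refine ⟨fun M => ModuleCat.hom_ext <| LinearMap.ext fun x => ?_, h⟩
    -- Over the zero ring every module is zero, so the two endomorphisms agree.
    have : Subsingleton R := subsingleton_of_zero_eq_one h.symm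
    have : Subsingleton (M ⊗ M : ModuleCat.{u} R) := Module.subsingleton R _
    exact Subsingleton.elim _ _
  · rintro ⟨b, hb⟩
    exact one_ne_zero (one_eq_zero_of_isDerivingTransformation hb)
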